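/- Let $\mathcal G=(\mathcal V,\mathcal E)$, $\mathcal E\subseteq\mathcal V\times\mathcal V$, be a finite directed graph with $n$ nodes in which every node $i$ has at least one outgoing edge; let $\mathcal N_i=\{h:(i,h)\in\mathcal E\}$ and $n_i=|\mathcal N_i|\ge 1$. Let $A\in\mathbb R^{\mathcal V\times\mathcal V}$ be the column-stochastic matrix with $A_{ij}=1/n_j$ if $(j,i)\in\mathcal E$ and $A_{ij}=0$ otherwise, let $m\in(0,1)$, and let $M=(1-m)A+\frac mn\mathbf 1\mathbf 1^\top$. The PageRank vector $\pi$ is the (existing and unique) vector with $M\pi=\pi$ and $\sum_i\pi_i=1$. Let $$r=\frac{m}{m-|\mathcal E|m+|\mathcal E|},$$ let the edges $\theta(0),\theta(1),\dots$ be independent and uniformly distributed on $\mathcal E$, let $x(0)$ be a stochastic vector (nonnegative entries with sum $1$), and let $\bar x(0)\in\mathbb R^{\mathcal V}$ be arbitrary. For $k\ge 0$, when $\theta(k)=(i,j)$, set $$x(k+1)=(1-r)\Big(I+\tfrac1{n_i}(e_je_i^\top-e_ie_i^\top)\Big)x(k)+\tfrac rn\mathbf 1 ,$$ that is, if $i\ne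 j$, $x_i(k+1)=(1-r)(1-\frac1{n_i})x_i(k)+\frac rn$, $x_j(k+1)=(1-r)(x_j(k)+\frac1{n_i}x_i(k))+\frac rn$, and $x_h(k+1)=(1-r)x_h(k)+\frac rn$ for $h\ne i,j$; and let $$\bar x_\ell(k+1)=\frac{k\,\bar x_\ell(k)+x_\ell(k+1)}{k+1}\qquad\text{for all }\ell\in\mathcal V,$$ so that $\bar x(k)=\frac1k\sum_{\ell=1}^{k}x(\ell)$ for $k\ge1$. Then $\lim_{k\to\infty}\bar x(k)=\pi$ almost surely. -/

import Mathlib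

open MeasureTheory ProbabilityTheory Filter Topology

namespace GossipPageRank

/-- The out-neighbours of the page `i` in the directed graph with edge set `E`, where
`(i, j) ∈ E` means that page `i` has a link to page `j`. -/
def outNeighbors {V : Type*} [Fintype V] [DecidableEq V] (E : Finset (V × V)) (i : V) :
    Finset V :=
  Finset.univ.filter (fun j => (i, j) ∈ E)

/-- The number of outgoing links of the page `i`. -/
def outDegree {V : Type*} [Fintype V] [DecidableEq V] (E : Finset (V × V)) (i : V) : ℕ :=
  (outNeighbors E i).card

/-- The link matrix: its `(i, j)` entry is `1 / n_j` if page `j` links to page `i`, and is zero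
otherwise. It is column-stochastic when every page has an outgoing link. -/
noncomputable def linkMatrix {V : Type*} [Fintype V] [DecidableEq V] (E : Finset (V × V)) :
    Matrix V V ℝ :=
  Matrix.of (fun i j => if i ∈ outNeighbors E j then 1 / (outDegree E j : ℝ) else 0)

/-- The matrix `(1 - m) A + (m / n) 𝟙 𝟙ᵀ`, with `A` the link matrix and `n` the number of pages. -/
noncomputable def googleMatrix {V : Type*} [Fintype V] [DecidableEq V] (E : Finset (V × V))
    (m : ℝ) : Matrix V V ℝ :=
  (1 - m) • linkMatrix E + (m / (Fintype.card V : ℝ)) • Matrix.of (fun _ _ => (1 : ℝ))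

/-- `p` is a PageRank vector: it is fixed by the matrix `M` above and its entries sum to one. -/
def IsPageRank {V : Type*} [Fintype V] [DecidableEq V] (E : Finset (V × V)) (m : ℝ)
    (p : V → ℝ) : Prop :=
  Matrix.mulVec (googleMatrix E m) p = p ∧ ∑ i, p i = 1

/-- One gossip update along the edge `e = (i, j)`: the page `i` gives the fraction `1 / n_i` of its
value to `j`, then all values are multiplied by `1 - r` and increased by `r / n`. In vector form,
`x ↦ (1 - r) (I + (1 / n_i) (e_j e_iᵀ - e_i e_iᵀ)) x + (r / n) 𝟙`. -/
noncomputable def gossipStep {V : Type*} [Fintype V] [DecidableEq V] (E : Finset (V × V)) (r : ℝ)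
    (e : V × V) (x : V → ℝ) : V → ℝ := fun h =>
  (1 - r) * (x h + (if h = e.2 then x e.1 / (outDegree E e.1 : ℝ) else 0)
    - (if h = e.1 then x e.1 / (outDegree E e.1 : ℝ) else 0)) + r / (Fintype.card V : ℝ)

/-- The states `x(k)` produced by the sequence of activated edges `θ(0), θ(1), …` from `x(0)`. -/
noncomputable def gossipState {V : Type*} [Fintype V] [DecidableEq V] (E : Finset (V × V)) (r : ℝ)
    (x₀ : V → ℝ) (θ : ℕ → V × V) : ℕ → V → ℝ
  | 0 => x₀
  | k + 1 => gossipStep E r (θ k) (gossipState E r x₀ θ k)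

/-- The running averages of a sequence `x`, computed recursively from an arbitrary initial value
by `xbar(k+1) = (k xbar(k) + x(k+1)) / (k+1)`. -/
noncomputable def runningAverage {V : Type*} (x : ℕ → V → ℝ) (xbar₀ : V → ℝ) : ℕ → V → ℝ
  | 0 => xbar₀
  | k + 1 => fun l => ((k : ℝ) * runningAverage x xbar₀ k l + x (k + 1) l) / ((k : ℝ) + 1)

end GossipPageRank

/-! Write `B = I - (1 - m) A`, `c = m - |E| m + |E|` and `d(k) = x(k+1) - (mean over e ∈ E of the
update of x(k) along e)`. The value of `r` is chosen so that `c d(k) = c (x(k+1) - x(k)) + B (x(k) -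
p)` (`sub_average_gossipStep`). The `d(k)` are bounded martingale differences, hence orthogonal, and
their averages vanish almost surely (`ae_tendsto_average_of_sum_update_eq_zero`). Averaging the
identity, the increments telescope to `O(1/n)`, so `B` applied to (average of `x` minus `p`) tends
to zero. Since `B` is invertible, the averages tend to `p` (`tendsto_runningAverage`). No
convergence of `x(k)` itself is needed. -/

namespace GossipPageRank

/-! ### Strong law for bounded orthogonal variables -/

section StrongLaw

/-- A sequence with bounded increments whose averages vanish along the squares has vanishing
averages. -/
theorem tendsto_div_of_tendsto_div_sq {S : ℕ → ℝ} {C : ℝ}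
    (hS : ∀ n, |S (n + 1) - S n| ≤ C)
    (hsq : Tendsto (fun n : ℕ => S (n ^ 2) / ((n ^ 2 : ℕ) : ℝ)) atTop (𝓝 0)) :
    Tendsto (fun n : ℕ => S n / n) atTop (𝓝 0) := by
  have shift : ∀ n : ℕ, n ≠ 0 → (S n + C * n) / n - C = S n / n := by
    intro n hn
    have : (n : ℝ) ≠ 0 := by exact_mod_cast hn
    field_simp
    ring
  -- Adding `C * n` makes the sequence monotone, so a subsequence with ratios tending to 1, here the
  -- squares, controls the whole.
  have key : Tendsto (fun n : ℕ => (S n + C * n) / n) atTop (𝓝 C) := by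
    refine tendsto_div_of_monotone_of_exists_subseq_tendsto_div (fun n => S n + C * n) C ?_ ?_
    · refine monotone_nat_of_le_succ fun n => ?_
      have := (abs_le.1 (hS n)).1
      push_cast
      linarith
    · intro a ha
      refine ⟨fun n => n ^ 2, ?_, tendsto_pow_atTop two_ne_zero, ?_⟩
      · have hlim : Tendsto (fun n : ℕ => (1 + 1 / (n : ℝ)) ^ 2) atTop (𝓝 ((1 + 0) ^ 2)) :=
          (tendsto_const_nhds.add tendsto_one_div_atTop_nhds_zero_nat).pow 2
        have h1 : ((1 : ℝ) + 0) ^ 2 < a := by simpa using ha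
        filter_upwards [hlim.eventually (eventually_lt_nhds h1), eventually_gt_atTop 0]
          with n hn hn0
        have hn' : (0 : ℝ) < n := by exact_mod_cast hn0
        have h2 : ((n : ℝ) + 1) ^ 2 = (1 + 1 / (n : ℝ)) ^ 2 * (n : ℝ) ^ 2 := by
          field_simp
        push_cast
        rw [h2]
        exact mul_le_mul_of_nonneg_right hn.le (by positivity)
      · have := hsq.add_const C
        rw [zero_add] at this
        refine this.congr' ?_
        filter_upwards [eventually_gt_atTop 0] with n hn
        rw [← shift (n ^ 2) (pow_ne_zero 2 hn.ne')]
        ring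
  have := key.sub_const C
  rw [sub_self] at this
  refine this.congr' ?_
  filter_upwards [eventually_gt_atTop 0] with n hn
  exact shift n hn.ne'

variable {Ω : Type*} [MeasurableSpace Ω] {μ : Measure Ω}

/-- Nonnegative functions with summable integrals tend to zero almost everywhere. -/
theorem ae_tendsto_zero_of_summable_integral {f : ℕ → Ω → ℝ} (hf : ∀ n, Integrable (f n) μ)
    (h0 : ∀ n ω, 0 ≤ f n ω) (hs : Summable fun n => ∫ ω, f n ω ∂μ) :
    ∀ᵐ ω ∂μ, Tendsto (fun n => f n ω) atTop (𝓝 0) := by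
  have hmeas : ∀ n, AEMeasurable (fun ω => ENNReal.ofReal (f n ω)) μ :=
    fun n => (hf n).aemeasurable.ennreal_ofReal
  -- By Tonelli the series has finite integral, so it converges a.e. and its terms vanish.
  have hfin : ∫⁻ ω, ∑' n, ENNReal.ofReal (f n ω) ∂μ ≠ ⊤ := by
    rw [lintegral_tsum hmeas]
    have : ∀ n, ∫⁻ ω, ENNReal.ofReal (f n ω) ∂μ = ENNReal.ofReal (∫ ω, f n ω ∂μ) := fun n =>
      (ofReal_integral_eq_lintegral_ofReal (hf n) (Eventually.of_forall (h0 n))).symm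
    simp_rw [this]
    exact hs.tsum_ofReal_ne_top
  filter_upwards [ae_lt_top' (AEMeasurable.tsum hmeas) hfin] with ω hω
  have := ENNReal.tendsto_atTop_zero_of_tsum_ne_top hω.ne
  have h2 := (ENNReal.tendsto_toReal ENNReal.zero_ne_top).comp this
  refine h2.congr fun n => ?_
  simp [ENNReal.toReal_ofReal (h0 n ω)]

/-- The strong law of large numbers for bounded orthogonal random variables. -/
theorem ae_tendsto_average_of_orthogonal [IsProbabilityMeasure μ] {d : ℕ → Ω → ℝ} {C : ℝ}
    (hC : 0 ≤ C) (hd : ∀ k, Measurable (d k)) (hbound : ∀ k ω, |d k ω| ≤ C)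
    (horth : ∀ j k, j < k → ∫ ω, d j ω * d k ω ∂μ = 0) :
    ∀ᵐ ω ∂μ, Tendsto (fun n : ℕ => (∑ k ∈ Finset.range n, d k ω) / n) atTop (𝓝 0) := by
  have hSmeas : ∀ n, Measurable fun ω => ∑ k ∈ Finset.range n, d k ω :=
    fun n => Finset.measurable_fun_sum _ fun k _ => hd k
  have hSbound : ∀ n ω, |∑ k ∈ Finset.range n, d k ω| ≤ n * C := by
    intro n ω
    refine (Finset.abs_sum_le_sum_abs _ _).trans ?_
    refine (Finset.sum_le_sum fun k _ => hbound k ω).trans ?_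
    simp
  have hint : ∀ {g : Ω → ℝ} (c : ℝ), Measurable g → (∀ ω, |g ω| ≤ c) → Integrable g μ :=
    fun c hg hb => Integrable.of_bound hg.aestronglyMeasurable c
      (Eventually.of_forall fun ω => by simpa using hb ω)
  have hdd : ∀ j k, Integrable (fun ω => d j ω * d k ω) μ := fun j k =>
    hint (C * C) ((hd j).mul (hd k)) fun ω => by
      rw [abs_mul]
      exact mul_le_mul (hbound j ω) (hbound k ω) (abs_nonneg _) hC
  have hSS : ∀ n, Integrable (fun ω => (∑ k ∈ Finset.range n, d k ω) ^ 2) μ := fun n =>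
    hint ((n * C) ^ 2) ((hSmeas n).pow_const 2) fun ω => by
      rw [abs_pow]
      exact pow_le_pow_left₀ (abs_nonneg _) (hSbound n ω) 2
  -- Orthogonality kills the cross terms, leaving linear growth; along `n ^ 2` the averages then
  -- have second moment at most `C ^ 2 / n ^ 2`, which is summable.
  have hvar : ∀ n : ℕ, ∫ ω, (∑ k ∈ Finset.range n, d k ω) ^ 2 ∂μ ≤ n * C ^ 2 := by
    intro n
    induction n with
    | zero => simp
    | succ n ih =>
      have hexp : ∀ ω, (∑ k ∈ Finset.range (n + 1), d k ω) ^ 2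
          = (∑ k ∈ Finset.range n, d k ω) ^ 2 + 2 * (∑ k ∈ Finset.range n, d k ω * d n ω)
            + d n ω * d n ω := by
        intro ω
        rw [Finset.sum_range_succ, ← Finset.sum_mul]
        ring
      have hcross : Integrable (fun ω => 2 * ∑ k ∈ Finset.range n, d k ω * d n ω) μ :=
        (integrable_finsetSum _ fun k _ => hdd k n).const_mul 2
      have hsq : ∫ ω, d n ω * d n ω ∂μ ≤ C ^ 2 := by
        have : ∫ ω, d n ω * d n ω ∂μ ≤ ∫ _, C ^ 2 ∂μ := by
          refine integral_mono (hdd n n) (integrable_const _) fun ω => ?_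
          have h1 := abs_le.1 (hbound n ω)
          change d n ω * d n ω ≤ C ^ 2
          nlinarith [h1.1, h1.2]
        simpa using this
      simp_rw [hexp]
      rw [integral_add (f := fun ω => (∑ k ∈ Finset.range n, d k ω) ^ 2
          + 2 * ∑ k ∈ Finset.range n, d k ω * d n ω) ((hSS n).add hcross) (hdd n n), integral_add (hSS n) hcross,
        integral_const_mul, integral_finsetSum _ fun k _ => hdd k n,
        Finset.sum_eq_zero fun k hk => horth k n (Finset.mem_range.1 hk)]
      push_cast
      linarith
  have hsub : ∀ᵐ ω ∂μ, Tendsto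
      (fun n : ℕ => ((∑ k ∈ Finset.range (n ^ 2), d k ω) / ((n ^ 2 : ℕ) : ℝ)) ^ 2) atTop (𝓝 0) := by
    refine ae_tendsto_zero_of_summable_integral (fun n => ?_) (fun n ω => sq_nonneg _) ?_
    · simp_rw [div_pow]
      exact (hSS _).div_const _
    · have hsum : Summable fun n : ℕ => C ^ 2 * (1 / (n : ℝ) ^ 2) :=
        (Real.summable_one_div_nat_pow.2 one_lt_two).mul_left _
      refine hsum.of_nonneg_of_le (fun n => integral_nonneg fun ω => sq_nonneg _) fun n => ?_
      simp_rw [div_pow]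
      rw [integral_div]
      rcases Nat.eq_zero_or_pos n with rfl | hn
      · simp
      have hn' : (0 : ℝ) < n := by exact_mod_cast hn
      refine (div_le_div_of_nonneg_right (hvar (n ^ 2)) (by positivity)).trans (le_of_eq ?_)
      push_cast
      field_simp
  filter_upwards [hsub] with ω hω
  refine tendsto_div_of_tendsto_div_sq (S := fun n => ∑ k ∈ Finset.range n, d k ω)
    (C := C) (fun n => ?_) ?_
  · simpa [Finset.sum_range_succ] using hbound n ω
  · have h := hω.sqrt
    simp_rw [Real.sqrt_sq_eq_abs, Real.sqrt_zero] at h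
    exact (tendsto_zero_iff_abs_tendsto_zero _).2 h

end StrongLaw

/-! ### Functions of the past of an i.i.d. sequence -/

section Independence

variable {Ω α : Type*} [MeasurableSpace Ω] {μ : Measure Ω} [Finite α] [MeasurableSpace α]
  [MeasurableSingletonClass α]

/-- A function of finitely many terms of a sequence of discrete random variables is measurable. -/
theorem measurable_comp_of_dependsOn {θ : ℕ → Ω → α} (hθ : ∀ k, Measurable (θ k)) {k : ℕ}
    {G : (ℕ → α) → ℝ} (hG : DependsOn G (Set.Iic k)) : Measurable fun ω => G fun l => θ l ω := by
  have heq : (fun ω => G fun l => θ l ω)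
      = (fun t : Finset.range (k + 1) → α => G fun l =>
          if h : l ∈ Finset.range (k + 1) then t ⟨l, h⟩ else t ⟨k, by simp⟩)
        ∘ fun ω (l : Finset.range (k + 1)) => θ l ω := by
    funext ω
    refine hG fun l hl => ?_
    have : l ∈ Finset.range (k + 1) := by simpa [Nat.lt_succ_iff] using hl
    simp only [this, dite_true]
  rw [heq]
  exact (measurable_of_countable _).comp (measurable_pi_lambda _ fun l => hθ l)

theorem integral_uniformOn [Fintype α] [DecidableEq α] (E : Finset α) (f : α → ℝ) :
    ∫ e, f e ∂(uniformOn (E : Set α)) = (∑ e ∈ E, f e) / E.card := by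
  rw [integral_fintype .of_finite]
  have h : ∀ e, (uniformOn (E : Set α)).real {e} = if e ∈ E then 1 / (E.card : ℝ) else 0 := by
    intro e
    rw [measureReal_def, ← Finset.coe_singleton, uniformOn_apply_finset]
    split_ifs with he
    · rw [Finset.inter_singleton_of_mem he]
      simp
    · rw [Finset.inter_singleton_of_notMem he]
      simp
  simp_rw [h, smul_eq_mul, ite_mul, zero_mul]
  rw [Finset.sum_ite_mem, Finset.univ_inter, Finset.sum_div]
  exact Finset.sum_congr rfl fun e _ => by ring

/-- Conditioning on the past: a function of `θ 0, …, θ k` whose sum over the values of the last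
variable vanishes has mean zero. -/
theorem integral_eq_zero_of_sum_update_eq_zero [DecidableEq α] [IsProbabilityMeasure μ]
    {θ : ℕ → Ω → α} (hθ : ∀ k, Measurable (θ k)) (hind : iIndepFun θ μ) {E : Finset α} {k : ℕ}
    (hunif : μ.map (θ k) = uniformOn (E : Set α)) {G : (ℕ → α) → ℝ}
    (hG : DependsOn G (Set.Iic k)) (hsum : ∀ s, ∑ e ∈ E, G (Function.update s k e) = 0) :
    ∫ ω, G (fun l => θ l ω) ∂μ = 0 := by
  have := Fintype.ofFinite α
  -- Coordinates beyond `k` are filled with the last value; `G` ignores them.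
  let F : (Finset.range k → α) × α → ℝ := fun p => G fun l =>
    if h : l ∈ Finset.range k then p.1 ⟨l, h⟩ else p.2
  let T : Ω → Finset.range k → α := fun ω l => θ l ω
  have hT : Measurable T := measurable_pi_lambda _ fun l => hθ l
  have hTθ : IndepFun T (θ k) μ := by
    have h := hind.indepFun_finset (Finset.range k) {k} (by simp) hθ
    exact h.comp (φ := id) (ψ := fun u : ({k} : Finset ℕ) → α => u ⟨k, by simp⟩) measurable_id
      (measurable_pi_apply _)
  have hGF : ∀ ω, G (fun l => θ l ω) = F (T ω, θ k ω) := by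
    intro ω
    refine hG fun l hl => ?_
    by_cases h : l ∈ Finset.range k
    · simp only [h, dite_true, T]
    · have : l = k := le_antisymm hl (by simpa using h)
      simp [this]
  have hsumF : ∀ t, ∑ e ∈ E, F (t, e) = 0 := by
    intro t
    -- An element of `α` is needed to extend `t` to a full sequence.
    rcases E.eq_empty_or_nonempty with rfl | ⟨a, -⟩
    · simp
    rw [← hsum fun l => if h : l ∈ Finset.range k then t ⟨l, h⟩ else a]
    refine Finset.sum_congr rfl fun e _ => hG fun l hl => ?_
    rcases eq_or_lt_of_le (show l ≤ k from hl) with rfl | h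
    · simp
    · simp [h, h.ne]
  have hFmeas : Measurable F := measurable_of_countable _
  have := Measure.isProbabilityMeasure_map (μ := μ) hT.aemeasurable
  have := Measure.isProbabilityMeasure_map (μ := μ) (hθ k).aemeasurable
  simp_rw [hGF]
  -- Past and present have a product law; Fubini integrates the present first, giving zero for each
  -- past.
  rw [← integral_map (φ := fun ω => (T ω, θ k ω)) (hT.prodMk (hθ k)).aemeasurable
      hFmeas.aestronglyMeasurable,
    (indepFun_iff_map_prod_eq_prod_map_map hT.aemeasurable (hθ k).aemeasurable).1 hTθ,
    integral_prod _ .of_finite, hunif]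
  simp_rw [integral_uniformOn, hsumF]
  simp

/-- Strong law for a bounded sequence of functions of the past whose conditional means vanish. -/
theorem ae_tendsto_average_of_sum_update_eq_zero [DecidableEq α] [IsProbabilityMeasure μ]
    {θ : ℕ → Ω → α} (hθ : ∀ k, Measurable (θ k)) (hind : iIndepFun θ μ) {E : Finset α}
    (hunif : ∀ k, μ.map (θ k) = uniformOn (E : Set α)) {D : ℕ → (ℕ → α) → ℝ} {C : ℝ}
    (hC : 0 ≤ C) (hbound : ∀ k s, |D k s| ≤ C) (hD : ∀ k, DependsOn (D k) (Set.Iic k))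
    (hsum : ∀ k s, ∑ e ∈ E, D k (Function.update s k e) = 0) :
    ∀ᵐ ω ∂μ, Tendsto (fun n : ℕ => (∑ k ∈ Finset.range n, D k fun l => θ l ω) / n)
      atTop (𝓝 0) := by
  refine ae_tendsto_average_of_orthogonal (d := fun k ω => D k fun l => θ l ω) hC
    (fun k => measurable_comp_of_dependsOn hθ (hD k)) (fun k ω => hbound k _) fun j k hjk => ?_
  refine integral_eq_zero_of_sum_update_eq_zero (G := fun s => D j s * D k s) hθ hind (hunif k)
    (fun s t hst => ?_) fun s => ?_
  · change D j s * D k s = D j t * D k t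
    rw [hD k hst, hD j fun l hl => hst l (le_trans hl hjk.le)]
  -- As `j < k`, the factor `D j` does not see coordinate `k` and leaves the sum.
  · have h : ∀ e, D j (Function.update s k e) = D j s := fun e =>
      hD j fun l hl => Function.update_of_ne (ne_of_lt (lt_of_le_of_lt hl hjk)) _ _
    simp_rw [h, ← Finset.mul_sum, hsum, mul_zero]

end Independence

end GossipPageRank

namespace GossipPageRank

variable {V : Type*} [Fintype V] [DecidableEq V] {E : Finset (V × V)}

/-! ### The PageRank equation -/

section PageRank

variable {m : ℝ}

theorem outDegree_pos (hE : ∀ i, (outNeighbors E i).Nonempty) (i : V) :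
    (0 : ℝ) < outDegree E i := by
  exact_mod_cast Finset.card_pos.2 (hE i)

theorem one_le_outDegree (hE : ∀ i, (outNeighbors E i).Nonempty) (i : V) :
    (1 : ℝ) ≤ outDegree E i := by
  exact_mod_cast Finset.card_pos.2 (hE i)

theorem linkMatrix_nonneg (i j : V) : 0 ≤ linkMatrix E i j := by
  simp only [linkMatrix, Matrix.of_apply]
  split_ifs <;> positivity

theorem sum_linkMatrix (hE : ∀ i, (outNeighbors E i).Nonempty) (j : V) :
    ∑ i, linkMatrix E i j = 1 := by
  have h := (outDegree_pos hE j).ne'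
  simp only [linkMatrix, Matrix.of_apply, Finset.sum_ite_mem, Finset.univ_inter,
    Finset.sum_const, nsmul_eq_mul]
  exact mul_one_div_cancel h

theorem sum_linkMatrix_mulVec (hE : ∀ i, (outNeighbors E i).Nonempty) (x : V → ℝ) :
    ∑ i, (linkMatrix E).mulVec x i = ∑ i, x i := by
  simp only [Matrix.mulVec, dotProduct]
  rw [Finset.sum_comm]
  simp_rw [← Finset.sum_mul, sum_linkMatrix hE, one_mul]

theorem isUnit_one_sub_smul_linkMatrix (hE : ∀ i, (outNeighbors E i).Nonempty) (hm0 : 0 < m)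
    (hm1 : m < 1) : IsUnit (1 - (1 - m) • linkMatrix E) := by
  rw [← Matrix.mulVec_injective_iff_isUnit, ← Matrix.coe_mulVecLin, injective_iff_map_eq_zero]
  intro z hz
  have hz' : ∀ i, z i = (1 - m) * (linkMatrix E).mulVec z i := fun i => by
    have := congrFun hz i
    simp only [Matrix.mulVecLin_apply, Matrix.sub_mulVec, Matrix.one_mulVec, Matrix.smul_mulVec,
      Pi.sub_apply, Pi.smul_apply, smul_eq_mul, Pi.zero_apply] at this
    linarith
  -- A column-stochastic matrix does not increase the ℓ¹ norm, so a kernel vector would be strictly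
  -- contracted.
  have hle : ∑ i, |z i| ≤ (1 - m) * ∑ i, |z i| := by
    rw [← sum_linkMatrix_mulVec hE fun i => |z i|, Finset.mul_sum,
      sum_linkMatrix_mulVec hE fun i => |z i|]
    refine Finset.sum_le_sum fun i _ => ?_
    rw [hz' i, abs_mul, abs_of_pos (sub_pos.2 hm1)]
    refine mul_le_mul_of_nonneg_left ?_ (sub_pos.2 hm1).le
    refine (Finset.abs_sum_le_sum_abs _ _).trans (le_of_eq (Finset.sum_congr rfl fun j _ => ?_))
    rw [abs_mul, abs_of_nonneg (linkMatrix_nonneg i j)]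
  have hnn : 0 ≤ ∑ i, |z i| := Finset.sum_nonneg fun i _ => abs_nonneg _
  have h0 : ∑ i, |z i| = 0 := by nlinarith
  funext i
  simpa using (Finset.sum_eq_zero_iff_of_nonneg fun i _ => abs_nonneg (z i)).1 h0 i
    (Finset.mem_univ i)

theorem googleMatrix_mulVec (x : V → ℝ) (i : V) :
    (googleMatrix E m).mulVec x i
      = (1 - m) * (linkMatrix E).mulVec x i + m / Fintype.card V * ∑ j, x j := by
  simp only [googleMatrix, Matrix.mulVec, dotProduct, Matrix.add_apply, Matrix.smul_apply,
    Matrix.of_apply, smul_eq_mul, mul_one, add_mul, Finset.sum_add_distrib, Finset.mul_sum,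
    mul_assoc]

/-- The PageRank vectors are the solutions of `(I - (1 - m) A) p = (m / n) 𝟙`. -/
theorem isPageRank_iff [Nonempty V] (hE : ∀ i, (outNeighbors E i).Nonempty) (hm0 : 0 < m)
    {p : V → ℝ} :
    IsPageRank E m p ↔
      (1 - (1 - m) • linkMatrix E).mulVec p = fun _ => m / (Fintype.card V : ℝ) := by
  have hcard : (Fintype.card V : ℝ) ≠ 0 := by exact_mod_cast Fintype.card_ne_zero
  simp only [IsPageRank, funext_iff, googleMatrix_mulVec, Matrix.sub_mulVec, Matrix.one_mulVec,
    Matrix.smul_mulVec, Pi.sub_apply, Pi.smul_apply, smul_eq_mul]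
  constructor
  · rintro ⟨h, hs⟩ i
    have := h i
    rw [hs] at this
    linarith
  · intro h
    have hs : ∑ i, p i = 1 := by
      have := Finset.sum_congr rfl fun i (_ : i ∈ Finset.univ) => h i
      rw [Finset.sum_sub_distrib, ← Finset.mul_sum, sum_linkMatrix_mulVec hE, Finset.sum_const,
        Finset.card_univ, nsmul_eq_mul, mul_div_cancel₀ _ hcard] at this
      exact mul_left_cancel₀ hm0.ne' (by linarith)
    refine ⟨fun i => ?_, hs⟩
    rw [hs]
    linarith [h i]

theorem existsUnique_isPageRank [Nonempty V] (hE : ∀ i, (outNeighbors E i).Nonempty)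
    (hm0 : 0 < m) (hm1 : m < 1) : ∃! p : V → ℝ, IsPageRank E m p := by
  simp_rw [isPageRank_iff hE hm0]
  have hu := isUnit_one_sub_smul_linkMatrix hE hm0 hm1
  exact Function.Bijective.existsUnique
    ⟨Matrix.mulVec_injective_iff_isUnit.2 hu, Matrix.mulVec_surjective_iff_isUnit.2 hu⟩ _

end PageRank

/-! ### The gossip update and its mean -/

section Gossip

variable {r : ℝ}

theorem gossipStep_mem_stdSimplex (hE : ∀ i, (outNeighbors E i).Nonempty) (hr0 : 0 ≤ r)
    (hr1 : r ≤ 1) (e : V × V) {x : V → ℝ} (hx : x ∈ stdSimplex ℝ V) :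
    gossipStep E r e x ∈ stdSimplex ℝ V := by
  have : Nonempty V := ⟨e.1⟩
  have hcard : (Fintype.card V : ℝ) ≠ 0 := by exact_mod_cast Fintype.card_ne_zero
  refine ⟨fun h => ?_, ?_⟩
  · have h1 : 0 ≤ if h = e.2 then x e.1 / (outDegree E e.1 : ℝ) else 0 := by
      split_ifs
      · exact div_nonneg (hx.1 _) (Nat.cast_nonneg _)
      · exact le_rfl
    have h2 : (if h = e.1 then x e.1 / (outDegree E e.1 : ℝ) else 0) ≤ x h := by
      split_ifs with he
      · rw [he]
        exact div_le_self (hx.1 _) (one_le_outDegree hE _)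
      · exact hx.1 h
    exact add_nonneg (mul_nonneg (by linarith) (by linarith)) (by positivity)
  · simp only [gossipStep]
    rw [Finset.sum_add_distrib, ← Finset.mul_sum, Finset.sum_sub_distrib, Finset.sum_add_distrib,
      hx.2]
    simp [mul_div_cancel₀ _ hcard]

theorem gossipState_mem_stdSimplex (hE : ∀ i, (outNeighbors E i).Nonempty) (hr0 : 0 ≤ r)
    (hr1 : r ≤ 1) {x₀ : V → ℝ} (hx₀ : x₀ ∈ stdSimplex ℝ V) (s : ℕ → V × V) (k : ℕ) :
    gossipState E r x₀ s k ∈ stdSimplex ℝ V := by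
  induction k with
  | zero => exact hx₀
  | succ k ih => exact gossipStep_mem_stdSimplex hE hr0 hr1 _ ih

/-- The strict bound matters: the edge `θ k` is fresh relative to `x(k)`. -/
theorem dependsOn_gossipState (x₀ : V → ℝ) (k : ℕ) :
    DependsOn (fun s => gossipState E r x₀ s k) (Set.Iio k) := by
  induction k with
  | zero => exact fun _ _ _ => rfl
  | succ k ih =>
    intro s t hst
    have h : gossipState E r x₀ s k = gossipState E r x₀ t k :=
      ih fun l hl => hst l (lt_trans hl k.lt_succ_self)
    simp only [gossipState, h, hst k k.lt_succ_self]

/-- The sum over all edges of the gossip updates of a state. -/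
theorem sum_gossipStep (hE : ∀ i, (outNeighbors E i).Nonempty) (x : V → ℝ) (h : V) :
    ∑ e ∈ E, gossipStep E r e x h
      = (1 - r) * (E.card * x h + (linkMatrix E).mulVec x h - x h)
        + E.card * (r / Fintype.card V) := by
  have hite : ∀ f : V × V → ℝ, ∑ e ∈ E, f e = ∑ i, ∑ j, if (i, j) ∈ E then f (i, j) else 0 := by
    intro f
    rw [← Fintype.sum_prod_type (f := fun e => if e ∈ E then f e else 0), Finset.sum_ite_mem,
      Finset.univ_inter]
  have hin : ∑ e ∈ E, (if h = e.2 then x e.1 / (outDegree E e.1 : ℝ) else 0)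
      = (linkMatrix E).mulVec x h := by
    rw [hite]
    simp only [Matrix.mulVec, dotProduct]
    refine Finset.sum_congr rfl fun i _ => ?_
    rw [Finset.sum_eq_single h (fun j _ hj => by simp [hj.symm]) (by simp)]
    simp only [linkMatrix, outNeighbors, Matrix.of_apply, Finset.mem_filter, Finset.mem_univ,
      true_and, if_true]
    split_ifs <;> ring
  have hout : ∑ e ∈ E, (if h = e.1 then x e.1 / (outDegree E e.1 : ℝ) else 0) = x h := by
    rw [hite, Finset.sum_eq_single h (fun i _ hi => by simp [hi.symm]) (by simp)]
    simp only [if_true]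
    rw [← Finset.sum_filter, Finset.sum_const, nsmul_eq_mul]
    exact mul_div_cancel₀ _ (outDegree_pos hE h).ne'
  simp only [gossipStep]
  rw [Finset.sum_add_distrib, ← Finset.mul_sum, Finset.sum_sub_distrib, Finset.sum_add_distrib,
    hin, hout]
  simp

/-- The deviation of a gossip update from its mean over all edges, in terms of the matrix
`I - (1 - m) A` that defines the PageRank vector. -/
theorem sub_average_gossipStep [Nonempty V] (hE : ∀ i, (outNeighbors E i).Nonempty) {m : ℝ}
    (hm0 : 0 < m) (hm1 : m < 1) (hr : r = m / (m - (E.card : ℝ) * m + (E.card : ℝ)))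
    (hcard : (0 : ℝ) < E.card) {p : V → ℝ} (hp : IsPageRank E m p) (x y : V → ℝ) (h : V) :
    (m - (E.card : ℝ) * m + E.card) * (y h - (∑ e ∈ E, gossipStep E r e x h) / E.card)
      = (m - (E.card : ℝ) * m + E.card) * (y h - x h)
        + (1 - (1 - m) • linkMatrix E).mulVec (x - p) h := by
  have hpos : 0 < m - (E.card : ℝ) * m + E.card := by nlinarith
  have hp' := congrFun ((isPageRank_iff hE hm0).1 hp) h
  have hn : (Fintype.card V : ℝ) ≠ 0 := by exact_mod_cast Fintype.card_ne_zero
  rw [Matrix.mulVec_sub, Pi.sub_apply, hp', sum_gossipStep hE, hr]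
  simp only [Matrix.sub_mulVec, Matrix.one_mulVec, Matrix.smul_mulVec, Pi.sub_apply,
    Pi.smul_apply, smul_eq_mul]
  have hc := hcard.ne'
  have hd := hpos.ne'
  -- Keeps the denominator of `r` atomic while fractions are cleared.
  generalize hD : m - (E.card : ℝ) * m + E.card = D at *
  field_simp
  rw [← hD]
  ring

end Gossip

/-! ### Deterministic passage to averages -/

section Averages

theorem tendsto_of_mulVec_sub_tendsto_zero {B : Matrix V V ℝ} (hB : IsUnit B) {u : ℕ → V → ℝ}
    {p : V → ℝ} (h : Tendsto (fun n => B.mulVec (u n - p)) atTop (𝓝 0)) :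
    Tendsto u atTop (𝓝 p) := by
  have hcont : Continuous fun v : V → ℝ => B⁻¹.mulVec v :=
    (Matrix.mulVecLin B⁻¹).continuous_of_finiteDimensional
  have h1 := (hcont.tendsto 0).comp h
  have h2 : Tendsto (fun n => u n - p) atTop (𝓝 0) := by
    simpa [Function.comp_def, Matrix.mulVec_mulVec,
      Matrix.nonsing_inv_mul _ ((Matrix.isUnit_iff_isUnit_det _).1 hB)] using h1
  simpa using h2.add_const p

/-- The factor `n` erases the arbitrary initial value at `n = 0`. -/
theorem natCast_mul_runningAverage {V : Type*} (x : ℕ → V → ℝ) (xbar₀ : V → ℝ) (n : ℕ) (h : V) :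
    n * runningAverage x xbar₀ n h = ∑ k ∈ Finset.range n, x (k + 1) h := by
  induction n with
  | zero => simp
  | succ n ih =>
    have : (n : ℝ) + 1 ≠ 0 := by positivity
    rw [Finset.sum_range_succ, ← ih, runningAverage]
    push_cast
    field_simp

/-- If the differences `x (k + 1) - x k`, corrected by a linear restoring term towards `p`, average
out to zero, then the running averages of a bounded sequence `x` converge to `p`. -/
theorem tendsto_runningAverage {x : ℕ → V → ℝ} {C : ℝ} (hx : ∀ k h, |x k h| ≤ C)
    {B : Matrix V V ℝ} (hB : IsUnit B) {c : ℝ} {p : V → ℝ} {d : ℕ → V → ℝ}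
    (hd : ∀ k h, c * d k h = c * (x (k + 1) h - x k h) + B.mulVec (x k - p) h)
    (hlim : ∀ h, Tendsto (fun n : ℕ => (∑ k ∈ Finset.range n, d k h) / n) atTop (𝓝 0))
    (xbar₀ : V → ℝ) : Tendsto (runningAverage x xbar₀) atTop (𝓝 p) := by
  have hdiff : ∀ h, Tendsto (fun n : ℕ => (x n h - x 0 h) / n) atTop (𝓝 0) := by
    intro h
    refine squeeze_zero_norm (fun n => ?_)
      ((tendsto_const_nhds (x := 2 * C)).div_atTop tendsto_natCast_atTop_atTop)
    rw [Real.norm_eq_abs, abs_div, Nat.abs_cast]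
    refine div_le_div_of_nonneg_right ((abs_sub _ _).trans ?_) (Nat.cast_nonneg n)
    linarith [hx n h, hx 0 h]
  let u : ℕ → V → ℝ := fun n => (n : ℝ)⁻¹ • ∑ k ∈ Finset.range n, x k
  have hu : Tendsto u atTop (𝓝 p) := by
    refine tendsto_of_mulVec_sub_tendsto_zero hB (tendsto_pi_nhds.2 fun h => ?_)
    have h0 := ((hlim h).const_mul c).sub ((hdiff h).const_mul c)
    rw [mul_zero, sub_zero] at h0
    refine h0.congr' ?_
    filter_upwards [eventually_gt_atTop 0] with n hn
    have hn' : (n : ℝ) ≠ 0 := by exact_mod_cast hn.ne'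
    have hup : u n - p = (n : ℝ)⁻¹ • ∑ k ∈ Finset.range n, (x k - p) := by
      rw [Finset.sum_sub_distrib, smul_sub, Finset.sum_const, Finset.card_range,
        ← Nat.cast_smul_eq_nsmul ℝ, smul_smul, inv_mul_cancel₀ hn', one_smul]
    have hsum : c * ∑ k ∈ Finset.range n, d k h
        = c * (x n h - x 0 h) + ∑ k ∈ Finset.range n, B.mulVec (x k - p) h := by
      rw [Finset.mul_sum, Finset.sum_congr rfl fun k _ => hd k h, Finset.sum_add_distrib,
        ← Finset.mul_sum, Finset.sum_range_sub fun k => x k h]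
    rw [hup, Matrix.mulVec_smul, Matrix.mulVec_sum, Pi.smul_apply, Finset.sum_apply, smul_eq_mul,
      ← mul_div_assoc, ← mul_div_assoc, hsum]
    field_simp
    ring
  refine tendsto_pi_nhds.2 fun h => ?_
  -- `u n` averages `x 0, …, x (n - 1)`, the running average `x 1, …, x n`; they differ by `(x n - x
  -- 0) / n`.
  have h0 := ((tendsto_pi_nhds.1 hu) h).add (hdiff h)
  rw [add_zero] at h0
  refine h0.congr' ?_
  filter_upwards [eventually_gt_atTop 0] with n hn
  have hn' : (n : ℝ) ≠ 0 := by exact_mod_cast hn.ne'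
  have hra := natCast_mul_runningAverage x xbar₀ n h
  have htel := Finset.sum_range_sub (fun k => x k h) n
  rw [Finset.sum_sub_distrib] at htel
  simp only [u, Pi.smul_apply, Finset.sum_apply, smul_eq_mul]
  field_simp
  linarith

end Averages

/-- Almost surely the running averages of the gossip states converge to the PageRank vector. -/
theorem ae_tendsto_runningAverage_gossipState [MeasurableSpace V] [MeasurableSingletonClass V]
    [Nonempty V] (hE : ∀ i, (outNeighbors E i).Nonempty) {m : ℝ} (hm0 : 0 < m) (hm1 : m < 1)
    {r : ℝ} (hr : r = m / (m - (E.card : ℝ) * m + (E.card : ℝ)))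
    {Ω : Type*} [MeasurableSpace Ω] {μ : Measure Ω} [IsProbabilityMeasure μ]
    {θ : ℕ → Ω → V × V} (hθ_meas : ∀ k, Measurable (θ k)) (hθ_indep : iIndepFun θ μ)
    (hθ_unif : ∀ k, μ.map (θ k) = uniformOn (E : Set (V × V)))
    {x₀ : V → ℝ} (hx₀ : x₀ ∈ stdSimplex ℝ V) (xbar₀ : V → ℝ) {p : V → ℝ}
    (hp : IsPageRank E m p) :
    ∀ᵐ ω ∂μ, Tendsto (runningAverage (gossipState E r x₀ fun k => θ k ω) xbar₀) atTop (𝓝 p) := by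
  have hcard : (1 : ℝ) ≤ E.card := by
    obtain ⟨i⟩ := ‹Nonempty V›
    obtain ⟨j, hj⟩ := hE i
    exact_mod_cast Finset.card_pos.2 ⟨(i, j), (Finset.mem_filter.1 hj).2⟩
  have hcard0 : (0 : ℝ) < E.card := by linarith
  have hpos : 0 < m - (E.card : ℝ) * m + E.card := by nlinarith
  have hr0 : 0 ≤ r := by
    rw [hr]
    positivity
  have hr1 : r ≤ 1 := by
    rw [hr, div_le_one hpos]
    nlinarith
  have hmem01 : ∀ {y : V → ℝ}, y ∈ stdSimplex ℝ V → ∀ h, 0 ≤ y h ∧ y h ≤ 1 := fun hy h =>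
    ⟨hy.1 h, hy.2 ▸ Finset.single_le_sum (fun i _ => hy.1 i) (Finset.mem_univ h)⟩
  have hx01 := fun s k => hmem01 (gossipState_mem_stdSimplex hE hr0 hr1 hx₀ s k)
  let D : V → ℕ → (ℕ → V × V) → ℝ := fun h k s =>
    gossipState E r x₀ s (k + 1) h
      - (∑ e ∈ E, gossipStep E r e (gossipState E r x₀ s k) h) / E.card
  have hlim : ∀ᵐ ω ∂μ, ∀ h, Tendsto
      (fun n : ℕ => (∑ k ∈ Finset.range n, D h k fun l => θ l ω) / n) atTop (𝓝 0) := by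
    rw [ae_all_iff]
    intro h
    refine ae_tendsto_average_of_sum_update_eq_zero hθ_meas hθ_indep hθ_unif zero_le_one
      (fun k s => ?_) (fun k s t hst => ?_) fun k s => ?_
    · have hstep : ∀ e ∈ E, 0 ≤ gossipStep E r e (gossipState E r x₀ s k) h ∧
          gossipStep E r e (gossipState E r x₀ s k) h ≤ 1 := fun e _ => hmem01
        (gossipStep_mem_stdSimplex hE hr0 hr1 e (gossipState_mem_stdSimplex hE hr0 hr1 hx₀ s k)) h
      have h0 : 0 ≤ (∑ e ∈ E, gossipStep E r e (gossipState E r x₀ s k) h) / E.card :=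
        div_nonneg (Finset.sum_nonneg fun e he => (hstep e he).1) hcard0.le
      have h1 : (∑ e ∈ E, gossipStep E r e (gossipState E r x₀ s k) h) / E.card ≤ 1 := by
        rw [div_le_one hcard0]
        simpa using Finset.sum_le_sum fun e he => (hstep e he).2
      have h2 := hx01 s (k + 1) h
      exact abs_le.2 ⟨by linarith [h2.1], by linarith [h2.2]⟩
    · have h1 : gossipState E r x₀ s k = gossipState E r x₀ t k :=
        dependsOn_gossipState x₀ k fun l hl => hst l (Set.Iio_subset_Iic_self hl)
      simp only [D, gossipState, h1, hst k Set.self_mem_Iic]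
    -- Varying edge `k` leaves `x(k)` fixed, so `D` sums deviations from a mean.
    · have h1 : ∀ e, gossipState E r x₀ (Function.update s k e) k = gossipState E r x₀ s k :=
        fun e => dependsOn_gossipState x₀ k fun l hl =>
          Function.update_of_ne (ne_of_lt hl) _ _
      simp only [D, gossipState, h1, Function.update_self]
      rw [Finset.sum_sub_distrib, Finset.sum_const, nsmul_eq_mul, mul_div_cancel₀ _ hcard0.ne',
        sub_self]
  filter_upwards [hlim] with ω hω
  exact tendsto_runningAverage (C := 1)
    (fun k h => by
      have := hx01 (fun l => θ l ω) k h
      exact abs_le.2 ⟨by linarith [this.1], this.2⟩)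
    (isUnit_one_sub_smul_linkMatrix hE hm0 hm1)
    (d := fun k h => D h k fun l => θ l ω)
    (fun k h => sub_average_gossipStep hE hm0 hm1 hr hcard0 hp _ _ h) hω xbar₀

end GossipPageRank

theorem theorem3 {V : Type*} [Fintype V] [DecidableEq V] [MeasurableSpace V]
    [MeasurableSingletonClass V]
    (E : Finset (V × V)) (hE : ∀ i : V, (GossipPageRank.outNeighbors E i).Nonempty)
    (m : ℝ) (hm0 : 0 < m) (hm1 : m < 1)
    (r : ℝ) (hr : r = m / (m - (E.card : ℝ) * m + (E.card : ℝ)))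
    {Ω : Type*} [MeasurableSpace Ω] (μ : Measure Ω) [IsProbabilityMeasure μ]
    (θ : ℕ → Ω → V × V) (hθ_meas : ∀ k, Measurable (θ k)) (hθ_indep : iIndepFun θ μ)
    (hθ_unif : ∀ k, μ.map (θ k) = uniformOn (E : Set (V × V)))
    (x₀ : V → ℝ) (hx₀ : x₀ ∈ stdSimplex ℝ V) (xbar₀ : V → ℝ) :
    (∃! p : V → ℝ, GossipPageRank.IsPageRank E m p) ∧
    ∀ p : V → ℝ, GossipPageRank.IsPageRank E m p →
      ∀ᵐ ω ∂μ, Tendsto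
        (fun k => GossipPageRank.runningAverage
          (GossipPageRank.gossipState E r x₀ (fun k => θ k ω)) xbar₀ k)
        atTop (𝓝 p) := by
  have hV : Nonempty V := by
    by_contra hV
    rw [not_nonempty_iff] at hV
    simpa using hx₀.2
  exact ⟨GossipPageRank.existsUnique_isPageRank hE hm0 hm1, fun p hp =>
    GossipPageRank.ae_tendsto_runningAverage_gossipState hE hm0 hm1 hr hθ_meas hθ_indep hθ_unif
      hx₀ xbar₀ hp⟩
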